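/- For $\mathbf u=(u_1,\dots,u_{n+1})\in S^n\subset\mathbb R^{n+1}$ write $u=(u_1,\dots,u_n)\in\mathbb R^n$, and put $$H_{\mathbf u}^+=\{x\in\mathbb R^n\mid \langle u,x\rangle\ge u_{n+1}\},\qquad H_{\mathbf u}^-=\{x\in\mathbb R^n\mid \langle u,x\rangle\le u_{n+1}\}.$$ **Theorem.** For $i=1,\dots,n$ let $A_i\subset\mathbb R^n$ be a compact convex set with non-empty interior such that $A_i\cap H$ is a singleton for every boundary point $x$ of $A_i$ and every supporting hyperplane $H$ of $A_i$ at $x$, and let $f_i:\mathbb R^n\times S^n\to\mathbb R$ be a continuous function with $f_i(x,-\mathbf u)=-f_i(x,\mathbf u)$ for all $(x,\mathbf u)\in\mathbb R^n\times S^n$. Then there exists $\mathbf u\in S^n$ such that for each $i=1,\dots,n$ one of the following holds. (i) Both $A_i\cap H_{\mathbf u}^+$ and $A_i\cap H_{\mathbf u}^-$ are non-empty, and $$\max_{x\in A_i\cap H_{\mathbf u}^+}f_i(x,\mathbf u)-\min_{x\in A_i\cap H_{\mathbf u}^+}f_i(x,\mathbf u)=\max_{x\in A_i\cap H_{\mathbf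 u}^-}f_i(x,\mathbf u)-\min_{x\in A_i\cap H_{\mathbf u}^-}f_i(x,\mathbf u).$$ (ii) One of $A_i\cap H_{\mathbf u}^+$ and $A_i\cap H_{\mathbf u}^-$ is empty and the other is $A_i$; further, $f_i(\cdot,\mathbf u)$ is constant on $A_i$. -/

import Mathlib

namespace BorsukUlamNLP

/-- `ℝⁿ` with the Euclidean inner product. -/
abbrev E (n : ℕ) : Type := EuclideanSpace ℝ (Fin n)

/-- The unit sphere `Sⁿ` of `ℝⁿ⁺¹`. -/
abbrev S (n : ℕ) : Type := Metric.sphere (0 : E (n + 1)) 1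

/-- The vector `u = (u₁, …, uₙ)` of the first `n` coordinates of `𝐮 = (u, uₙ₊₁) ∈ Sⁿ`. -/
noncomputable def head {n : ℕ} (u : S n) : E n :=
  WithLp.toLp 2 (fun i : Fin n => (u : E (n + 1)) i.castSucc)

/-- The last coordinate `uₙ₊₁` of `𝐮 = (u, uₙ₊₁) ∈ Sⁿ`. -/
noncomputable def last {n : ℕ} (u : S n) : ℝ :=
  (u : E (n + 1)) (Fin.last n)

/-- The closed set `H⁺ = {x ∈ ℝⁿ | ⟨u, x⟩ ≥ uₙ₊₁}`. -/
def halfPos {n : ℕ} (u : S n) : Set (E n) :=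
  {x | inner ℝ (head u) x ≥ last u}

/-- The closed set `H⁻ = {x ∈ ℝⁿ | ⟨u, x⟩ ≤ uₙ₊₁}`. -/
def halfNeg {n : ℕ} (u : S n) : Set (E n) :=
  {x | inner ℝ (head u) x ≤ last u}

/-- `H` is a supporting hyperplane of `A` at `x`: a hyperplane `{y | ⟨v, y⟩ = c}`, `v ≠ 0`, through
`x` with `A` on one side of it (replacing `(v, c)` by `(-v, -c)` exchanges the two sides). -/
def IsSupportingHyperplaneAt {n : ℕ} (A H : Set (E n)) (x : E n) : Prop :=
  ∃ (v : E n) (c : ℝ), v ≠ 0 ∧ H = {y | inner ℝ v y = c} ∧ x ∈ H ∧ ∀ y ∈ A, inner ℝ v y ≤ c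

end BorsukUlamNLP

/-! Let `osc` be the oscillation of `f i (·, u)` on `A i ∩ H⁺`, set to `0` when that set is empty.
Strict convexity makes it continuous (`continuous_osc`). A common zero of the odd functions `osc u -
osc (-u)`, given by `borsuk_ulam`, is the required `u`: since `f i` is odd in `u`, `osc (-u)` is the
oscillation on `A i ∩ H⁻`.

Borsuk–Ulam is proved algebraically. By Stone–Weierstrass, odd functions are approximated by odd
polynomials, which in the chart `(x, 1)` become polynomials `h i` of degree at most one common odd
`d`. For all but countably many `s`, the system `x i ^ d + s * h i = 0` has a quotient algebra of
dimension `d ^ n`. This is odd, so the commuting multiplications by the variables share a real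
eigenvector, whose eigenvalues are a real solution. Large `s` makes all the functions small at that
point of the sphere; compactness then gives an exact zero. -/

/-! ### Common eigenvectors in odd dimension. -/

theorem Polynomial.Monic.exists_isRoot_of_odd_natDegree {p : Polynomial ℝ} (hp : p.Monic)
    (hodd : Odd p.natDegree) : ∃ x, p.IsRoot x := by
  have hd : 0 < p.natDegree := hodd.pos
  have h1 : Filter.Tendsto (fun x => p.eval x) Filter.atTop Filter.atTop :=
    p.tendsto_atTop_of_leadingCoeff_nonneg (Polynomial.natDegree_pos_iff_degree_pos.mp hd)
      (by rw [hp.leadingCoeff]; exact zero_le_one)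
  have hn : (p.comp (-Polynomial.X)).natDegree = p.natDegree := by
    rw [Polynomial.natDegree_comp, Polynomial.natDegree_neg, Polynomial.natDegree_X, mul_one]
  have h2 : Filter.Tendsto (fun x => (p.comp (-Polynomial.X)).eval x) Filter.atTop
      Filter.atBot := by
    apply Polynomial.tendsto_atBot_of_leadingCoeff_nonpos
    · rw [← Polynomial.natDegree_pos_iff_degree_pos, hn]; exact hd
    · rw [Polynomial.leadingCoeff_comp (by simp), hp.leadingCoeff]
      simp [hodd.neg_one_pow]
  obtain ⟨a, ha⟩ := (h1.eventually_ge_atTop 0).exists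
  obtain ⟨b, hb⟩ := (h2.eventually_le_atBot 0).exists
  simp only [Polynomial.eval_comp, Polynomial.eval_neg, Polynomial.eval_X] at hb
  exact mem_range_of_exists_le_of_exists_ge p.continuous ⟨_, hb⟩ ⟨_, ha⟩

theorem Module.End.exists_hasEigenvalue_of_odd_finrank {V : Type*} [AddCommGroup V] [Module ℝ V]
    [FiniteDimensional ℝ V] (hV : Odd (Module.finrank ℝ V)) (T : Module.End ℝ V) :
    ∃ a, T.HasEigenvalue a := by
  obtain ⟨a, ha⟩ := T.charpoly_monic.exists_isRoot_of_odd_natDegree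
    (by rwa [LinearMap.charpoly_natDegree])
  exact ⟨a, (Module.End.hasEigenvalue_iff_isRoot_charpoly T a).mpr ha⟩

/-- If some `T i` is not scalar, take a real eigenvalue `a`. The kernel and range of `T i - a` are
proper subspaces, invariant under every `T j`, and their dimensions have odd sum; induction applies
to the odd one. -/
theorem Module.End.exists_common_eigenvector_of_odd_finrank {ι : Type*} (k : ℕ) :
    ∀ {V : Type*} [AddCommGroup V] [Module ℝ V] [FiniteDimensional ℝ V],
      Module.finrank ℝ V = k → Odd k → ∀ T : ι → Module.End ℝ V,
        (∀ i j, Commute (T i) (T j)) → ∃ v : V, v ≠ 0 ∧ ∃ a : ι → ℝ, ∀ i, T i v = a i • v := by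
  induction k using Nat.strong_induction_on with
  | _ k ih =>
  intro V _ _ _ hk hodd T hT
  by_cases hs : ∀ i, ∃ a : ℝ, ∀ v, T i v = a • v
  · choose a ha using hs
    have : Nontrivial V := Module.nontrivial_of_finrank_pos (R := ℝ) (hk ▸ hodd.pos)
    obtain ⟨v, hv⟩ := exists_ne (0 : V)
    exact ⟨v, hv, a, fun i => ha i v⟩
  push Not at hs
  obtain ⟨i, hi⟩ := hs
  obtain ⟨a, ha⟩ := (T i).exists_hasEigenvalue_of_odd_finrank (hk ▸ hodd)
  set U : Module.End ℝ V := T i - algebraMap ℝ _ a with hU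
  have hcomm : ∀ j, Commute (T j) U := fun j =>
    (hT j i).sub_right (Algebra.commute_algebraMap_right a _)
  have key : ∀ W : Submodule ℝ V, Odd (Module.finrank ℝ W) → W ≠ ⊤ →
      (∀ j, ∀ x ∈ W, T j x ∈ W) → ∃ v : V, v ≠ 0 ∧ ∃ a : ι → ℝ, ∀ i, T i v = a i • v := by
    intro W hWodd hW hinv
    obtain ⟨v, hv, b, hb⟩ := ih (Module.finrank ℝ W)
      (hk ▸ Submodule.finrank_lt hW) rfl hWodd (fun j => (T j).restrict (hinv j)) (by
        intro j l
        ext x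
        simpa using congrArg (fun S : Module.End ℝ V => S x) (hT j l))
    refine ⟨v, by simpa using hv, b, fun j => ?_⟩
    simpa using congrArg Subtype.val (hb j)
  have hker : LinearMap.ker U ≠ ⊤ := by
    intro h
    obtain ⟨v, hv⟩ := hi a
    apply hv
    have : U v = 0 := by rw [← LinearMap.mem_ker, h]; trivial
    simpa [hU, sub_eq_zero, Module.algebraMap_end_apply] using this
  have hbot : LinearMap.ker U ≠ ⊥ := by
    obtain ⟨v, hv⟩ := ha.exists_hasEigenvector
    intro h
    apply hv.2
    have : v ∈ LinearMap.ker U := by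
      simp [hU, Module.algebraMap_end_apply, hv.apply_eq_smul]
    rwa [h] at this
  have hrange : LinearMap.range U ≠ ⊤ := fun h =>
    hbot (LinearMap.ker_eq_bot.mpr (LinearMap.injective_iff_surjective.mpr
      (LinearMap.range_eq_top.mp h)))
  have hsum := U.finrank_range_add_finrank_ker
  rcases Nat.even_or_odd (Module.finrank ℝ (LinearMap.ker U)) with he | ho
  · refine key (LinearMap.range U) ?_ hrange ?_
    · rw [hk] at hsum
      by_contra hc
      rw [Nat.not_odd_iff_even] at hc
      exact Nat.not_even_iff_odd.mpr hodd (hsum ▸ hc.add he)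
    · rintro j _ ⟨y, rfl⟩
      exact ⟨T j y, by simpa using congrArg (fun S : Module.End ℝ V => S y) (hcomm j).eq.symm⟩
  · refine key (LinearMap.ker U) ho hker ?_
    intro j x hx
    rw [LinearMap.mem_ker] at hx ⊢
    have := congrArg (fun S : Module.End ℝ V => S x) (hcomm j).eq.symm
    simpa [hx] using this

/-! ### Deforming the powers `X i ^ d` into polynomials `g i`. -/

open MvPolynomial

section AdicMonomial

variable {σ R S : Type*} [Fintype σ] [CommRing R] [CommRing S]

/-- The product of the monomial with exponents `e i % d` and the powers `g i ^ (e i / d)`. -/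
noncomputable def adicMonomial (d : ℕ) (g : σ → MvPolynomial σ R) (e : σ →₀ ℕ) :
    MvPolynomial σ R :=
  monomial (e.mapRange (· % d) (Nat.zero_mod d)) 1 * ∏ i, g i ^ (e i / d)

theorem totalDegree_adicMonomial_le {d : ℕ} {g : σ → MvPolynomial σ R}
    (hg : ∀ i, (g i).totalDegree ≤ d) (e : σ →₀ ℕ) :
    (adicMonomial d g e).totalDegree ≤ e.degree := by
  have h1 : (monomial (e.mapRange (· % d) (Nat.zero_mod d)) (1 : R)).totalDegree
      ≤ ∑ i, e i % d := by
    refine (totalDegree_monomial_le _ _).trans (le_of_eq ?_)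
    rw [Finsupp.sum_fintype _ _ (fun _ => rfl)]
    rfl
  have h2 : (∏ i, g i ^ (e i / d)).totalDegree ≤ ∑ i, (e i / d) * d := by
    refine (totalDegree_finsetProd _ _).trans (Finset.sum_le_sum fun i _ => ?_)
    exact (totalDegree_pow _ _).trans (Nat.mul_le_mul_left _ (hg i))
  calc _ ≤ ∑ i, e i % d + ∑ i, (e i / d) * d := (totalDegree_mul _ _).trans (add_le_add h1 h2)
    _ = e.degree := by
      rw [← Finset.sum_add_distrib, Finsupp.degree_eq_sum]
      exact Finset.sum_congr rfl fun i _ => Nat.mod_add_div' _ _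

theorem adicMonomial_X_pow (d : ℕ) (e : σ →₀ ℕ) :
    adicMonomial d (fun i => (X i : MvPolynomial σ R) ^ d) e = monomial e 1 := by
  rw [adicMonomial, monomial_eq, monomial_eq, C_1, one_mul, one_mul,
    Finsupp.prod_fintype _ _ (fun _ => pow_zero _), Finsupp.prod_fintype _ _ (fun _ => pow_zero _),
    ← Finset.prod_mul_distrib]
  refine Finset.prod_congr rfl fun i _ => ?_
  rw [← pow_mul, ← pow_add, Finsupp.mapRange_apply, Nat.mod_add_div]

theorem map_adicMonomial (φ : R →+* S) (d : ℕ) (g : σ → MvPolynomial σ R) (e : σ →₀ ℕ) :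
    map φ (adicMonomial d g e) = adicMonomial d (fun i => map φ (g i)) e := by
  simp [adicMonomial, map_monomial]

theorem adicMonomial_single_add [DecidableEq σ] {d : ℕ} (hd : 0 < d) (g : σ → MvPolynomial σ R)
    (i : σ) (e : σ →₀ ℕ) :
    adicMonomial d g (Finsupp.single i d + e) = g i * adicMonomial d g e := by
  have h1 : (Finsupp.single i d + e).mapRange (· % d) (Nat.zero_mod d)
      = e.mapRange (· % d) (Nat.zero_mod d) := by
    ext j
    by_cases h : i = j
    · subst h; simp
    · simp [Finsupp.single_eq_of_ne' h]
  have h2 : ∏ j, g j ^ ((Finsupp.single i d + e) j / d) = g i * ∏ j, g j ^ (e j / d) := by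
    rw [← Finset.mul_prod_erase _ _ (Finset.mem_univ i),
      ← Finset.mul_prod_erase (f := fun j => g j ^ (e j / d)) _ (Finset.mem_univ i), ← mul_assoc]
    congr 1
    · simp [Nat.add_div_left _ hd, pow_succ']
    · refine Finset.prod_congr rfl fun j hj => ?_
      rw [Finsupp.add_apply, Finsupp.single_eq_of_ne (Finset.ne_of_mem_erase hj), zero_add]
  rw [adicMonomial, h1, h2, adicMonomial]
  ring

/-- The linear map sending the monomial with exponents `e` to `adicMonomial d g e`. -/
noncomputable def adicMap (d : ℕ) (g : σ → MvPolynomial σ R) :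
    MvPolynomial σ R →ₗ[R] MvPolynomial σ R :=
  (basisMonomials σ R).constr R (adicMonomial d g)

theorem adicMap_monomial (d : ℕ) (g : σ → MvPolynomial σ R) (e : σ →₀ ℕ) :
    adicMap d g (monomial e 1) = adicMonomial d g e := by
  have := (basisMonomials σ R).constr_basis R (adicMonomial d g) e
  rwa [coe_basisMonomials] at this

theorem adicMap_eq_sum (d : ℕ) (g : σ → MvPolynomial σ R) (p : MvPolynomial σ R) :
    adicMap d g p = ∑ e ∈ p.support, p.coeff e • adicMonomial d g e := by
  conv_lhs => rw [p.as_sum, map_sum]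
  refine Finset.sum_congr rfl fun e _ => ?_
  rw [← adicMap_monomial, ← map_smul, smul_monomial, smul_eq_mul, mul_one]

theorem adicMap_X_pow_mul {d : ℕ} (hd : 0 < d) (g : σ → MvPolynomial σ R) (i : σ)
    (p : MvPolynomial σ R) : adicMap d g (X i ^ d * p) = g i * adicMap d g p := by
  classical
  have : adicMap d g ∘ₗ LinearMap.mulLeft R (X i ^ d) =
      LinearMap.mulLeft R (g i) ∘ₗ adicMap d g := by
    refine (basisMonomials σ R).ext fun e => ?_
    rw [coe_basisMonomials]
    simp only [LinearMap.comp_apply, LinearMap.mulLeft_apply]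
    rw [← monomial_single_add, adicMap_monomial, adicMap_monomial, adicMonomial_single_add hd]
  exact LinearMap.congr_fun this p

theorem totalDegree_adicMap_le {d : ℕ} {g : σ → MvPolynomial σ R}
    (hg : ∀ i, (g i).totalDegree ≤ d) (p : MvPolynomial σ R) :
    (adicMap d g p).totalDegree ≤ p.totalDegree := by
  rw [adicMap_eq_sum]
  refine totalDegree_finsetSum_le fun e he => ?_
  refine (totalDegree_smul_le _ _).trans ((totalDegree_adicMonomial_le hg e).trans ?_)
  rw [Finsupp.degree_eq_sum]
  have := le_totalDegree he
  rwa [Finsupp.sum_fintype _ _ (fun _ => rfl)] at this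

end AdicMonomial

section Generic

theorem totalDegree_X_pow_add_C_mul_le {σ R : Type*} [CommRing R] [Nontrivial R] {d : ℕ}
    {h : MvPolynomial σ R} (hh : h.totalDegree ≤ d) (s : R) (i : σ) :
    (X i ^ d + C s * h).totalDegree ≤ d :=
  (totalDegree_add _ _).trans (max_le (totalDegree_X_pow i d).le
    ((totalDegree_mul _ _).trans (by simpa using hh)))

variable {σ : Type*} [Fintype σ]

/-- The square matrix of coefficients in degrees at most `m` has entries polynomial in `s` and is
the identity at `s = 0`. Its determinant is thus a nonzero polynomial, and a bad `s` is one of its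
roots. -/
theorem finite_setOf_not_injOn_adicMap {d : ℕ} (h : σ → MvPolynomial σ ℝ) (m : ℕ) :
    {s : ℝ | ∃ p : MvPolynomial σ ℝ, p ≠ 0 ∧ p.totalDegree ≤ m ∧
      adicMap d (fun i => X i ^ d + C s * h i) p = 0}.Finite := by
  classical
  let I := {e : σ →₀ ℕ // e ∈ (Finsupp.finite_of_degree_le m : {e : σ →₀ ℕ | e.degree ≤ m}.Finite).toFinset}
  let G : σ → MvPolynomial σ (Polynomial ℝ) :=
    fun i => X i ^ d + C Polynomial.X * map Polynomial.C (h i)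
  let M : Matrix I I (Polynomial ℝ) := Matrix.of fun e' e => (adicMonomial d G e.1).coeff e'.1
  have hM : ∀ s, (Polynomial.evalRingHom s).mapMatrix M =
      Matrix.of fun e' e : I => (adicMonomial d (fun i => X i ^ d + C s * h i) e.1).coeff e'.1 := by
    intro s
    ext e' e
    simp only [M, RingHom.mapMatrix_apply, Matrix.map_apply, Matrix.of_apply]
    rw [← coeff_map, map_adicMonomial]
    congr 3
    funext i
    have hc : (Polynomial.evalRingHom s).comp Polynomial.C = RingHom.id ℝ := by ext; simp
    simp [G, map_map, hc, map_id]
  have hdet : M.det ≠ 0 := by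
    intro h0
    have h1 : ((Polynomial.evalRingHom 0).mapMatrix M).det = 0 := by
      rw [← RingHom.map_det, h0, map_zero]
    have h2 : (Polynomial.evalRingHom 0).mapMatrix M = 1 := by
      rw [hM]
      ext e' e
      simp only [map_zero, zero_mul, add_zero, adicMonomial_X_pow, Matrix.of_apply,
        coeff_monomial, Matrix.one_apply]
      exact if_congr (eq_comm.trans Subtype.ext_iff.symm) rfl rfl
    rw [h2, Matrix.det_one] at h1
    exact one_ne_zero h1
  refine (Polynomial.finite_setOfPred_isRoot hdet).subset ?_
  rintro s ⟨p, hp0, hpm, hp⟩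
  by_contra hs
  have hdets : ((Polynomial.evalRingHom s).mapMatrix M).det ≠ 0 := by
    rw [← RingHom.map_det]; exact hs
  apply hp0
  have hsupp : ∀ e ∈ p.support, e.degree ≤ m := fun e he => by
    refine le_trans ?_ hpm
    rw [Finsupp.degree_eq_sum]
    have := le_totalDegree he
    rwa [Finsupp.sum_fintype _ _ (fun _ => rfl)] at this
  have hmul : ((Polynomial.evalRingHom s).mapMatrix M).mulVec (fun e : I => p.coeff e.1) = 0 := by
    funext e'
    rw [hM, Matrix.mulVec, dotProduct, Pi.zero_apply]
    have := congrArg (coeff e'.1) hp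
    rw [adicMap_eq_sum, coeff_sum, coeff_zero] at this
    rw [← this]
    simp only [Matrix.of_apply]
    rw [Finset.sum_coe_sort (Finsupp.finite_of_degree_le m).toFinset (fun e =>
      coeff e'.1 (adicMonomial d (fun i => X i ^ d + C s * h i) e) * coeff e p)]
    refine (Finset.sum_subset_zero_on_sdiff (fun e he => ?_) (fun e he => ?_) (fun e he => ?_)).symm
    · simpa using hsupp e he
    · simp only [Finset.mem_sdiff, mem_support_iff, not_not] at he
      rw [he.2, mul_zero]
    · rw [coeff_smul, smul_eq_mul, mul_comm]
  have hv := Matrix.eq_zero_of_mulVec_eq_zero hdets hmul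
  ext e
  by_cases he : e ∈ p.support
  · simpa using congrFun hv ⟨e, by simpa using hsupp e he⟩
  · simpa using he

/-- The map preserves each finite-dimensional space of polynomials of bounded degree, so injectivity
implies surjectivity. -/
theorem countable_setOf_not_bijective_adicMap {d : ℕ} (h : σ → MvPolynomial σ ℝ)
    (hh : ∀ i, (h i).totalDegree ≤ d) :
    {s : ℝ | ¬ Function.Bijective (adicMap d (fun i => X i ^ d + C s * h i))}.Countable := by
  refine (Set.countable_iUnion fun m =>
    (finite_setOf_not_injOn_adicMap (d := d) h m).countable).mono ?_
  intro s hs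
  by_contra hc
  simp only [Set.mem_iUnion, Set.mem_ofPred_eq, not_exists, not_and] at hc
  apply hs
  have hinj : Function.Injective (adicMap d (fun i => X i ^ d + C s * h i)) := by
    rw [injective_iff_map_eq_zero]
    intro p hp
    by_contra hp0
    exact hc _ p hp0 le_rfl hp
  refine ⟨hinj, fun q => ?_⟩
  have hmaps : ∀ p ∈ restrictTotalDegree σ ℝ q.totalDegree,
      adicMap d (fun i => X i ^ d + C s * h i) p ∈ restrictTotalDegree σ ℝ q.totalDegree := by
    intro p hp
    rw [mem_restrictTotalDegree] at hp ⊢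
    exact (totalDegree_adicMap_le (fun i => totalDegree_X_pow_add_C_mul_le (hh i) s i) p).trans hp
  have hinj' : Function.Injective ((adicMap d (fun i => X i ^ d + C s * h i)).restrict hmaps) := by
    intro a b hab
    exact Subtype.ext (hinj (by simpa using congrArg Subtype.val hab))
  obtain ⟨p, hp⟩ := LinearMap.injective_iff_surjective.mp hinj'
    ⟨q, (mem_restrictTotalDegree _ _ _).mpr le_rfl⟩
  exact ⟨p.1, by simpa using congrArg Subtype.val hp⟩

end Generic

/-! ### Real zeros of polynomial systems of odd degree. -/

open MvPolynomial

section OddSystem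

variable {σ : Type*} [Fintype σ]

/-- The coefficients of a polynomial at the monomials all of whose exponents are less than `d`. -/
noncomputable def boxCoeff (σ : Type*) [Fintype σ] (d : ℕ) :
    MvPolynomial σ ℝ →ₗ[ℝ] ((σ → Fin d) → ℝ) :=
  LinearMap.pi fun a => lcoeff ℝ (Finsupp.equivFunOnFinite.symm fun i => (a i : ℕ))

theorem boxCoeff_apply (d : ℕ) (p : MvPolynomial σ ℝ) (a : σ → Fin d) :
    boxCoeff σ d p a = p.coeff (Finsupp.equivFunOnFinite.symm fun i => (a i : ℕ)) := rfl

theorem boxCoeff_surjective (d : ℕ) : Function.Surjective (boxCoeff σ d) := by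
  classical
  intro c
  refine ⟨∑ a, monomial (Finsupp.equivFunOnFinite.symm fun i => (a i : ℕ)) (c a), ?_⟩
  funext b
  rw [boxCoeff_apply, coeff_sum, Finset.sum_eq_single b]
  · rw [coeff_monomial, if_pos rfl]
  · intro a _ hab
    rw [coeff_monomial, if_neg]
    intro h
    apply hab
    funext i
    exact Fin.ext (congrFun (Finsupp.equivFunOnFinite.symm.injective h) i)
  · simp

theorem boxCoeff_X_pow_mul (d : ℕ) (i : σ) (p : MvPolynomial σ ℝ) :
    boxCoeff σ d (X i ^ d * p) = 0 := by
  classical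
  funext a
  rw [boxCoeff_apply, X_pow_eq_monomial, coeff_monomial_mul', if_neg, Pi.zero_apply]
  intro h
  have := h i
  simp only [Finsupp.single_eq_same, Finsupp.equivFunOnFinite_symm_apply_apply] at this
  exact absurd (a i).2 (by omega)

/-- `adicMap` turns multiplication by `X i ^ d` into multiplication by `g i`, so it carries the
ideal of the `X i ^ d` onto that of the `g i`. The former consists of the polynomials whose
monomials all have some exponent at least `d`. -/
theorem adicMap_mem_span_iff {d : ℕ} (hd : 0 < d) {g : σ → MvPolynomial σ ℝ}
    (hg : Function.Bijective (adicMap d g)) (p : MvPolynomial σ ℝ) :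
    adicMap d g p ∈ Ideal.span (Set.range g) ↔ boxCoeff σ d p = 0 := by
  classical
  constructor
  · intro h
    obtain ⟨c, hc⟩ := (Ideal.mem_span_range_iff_exists_fun).mp h
    choose b hb using fun i => hg.2 (c i)
    have : p = ∑ i, X i ^ d * b i := hg.1 <| by
      rw [← hc, map_sum]
      exact Finset.sum_congr rfl fun i _ => by rw [adicMap_X_pow_mul hd, hb, mul_comm]
    rw [this, map_sum]
    exact Finset.sum_eq_zero fun i _ => boxCoeff_X_pow_mul d i _
  · intro h
    rw [adicMap_eq_sum]
    refine sum_mem fun e he => ?_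
    rw [smul_eq_C_mul]
    refine Ideal.mul_mem_left _ _ ?_
    obtain ⟨i, hi⟩ : ∃ i, d ≤ e i := by
      by_contra! hlt
      have := congrFun h fun i => ⟨e i, hlt i⟩
      rw [boxCoeff_apply] at this
      apply mem_support_iff.mp he
      rw [Pi.zero_apply] at this
      rw [← this]
      congr 1
      ext i
      rfl
    have hsplit : Finsupp.single i d + (e - Finsupp.single i d) = e :=
      add_tsub_cancel_of_le (Finsupp.single_le_iff.mpr hi)
    rw [← hsplit, adicMonomial_single_add hd]
    exact Ideal.mul_mem_right _ _ (Ideal.subset_span ⟨i, rfl⟩)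

/-- On a common eigenvector of the multiplications by `φ (X i)`, with eigenvalues `a i`, each `φ p`
acts as the scalar `eval a p`. -/
theorem exists_eval_eq_zero_of_odd_finrank {σ B : Type*} [CommRing B] [Algebra ℝ B]
    [FiniteDimensional ℝ B] (hB : Odd (Module.finrank ℝ B)) (φ : MvPolynomial σ ℝ →ₐ[ℝ] B) :
    ∃ a : σ → ℝ, ∀ p, φ p = 0 → eval a p = 0 := by
  obtain ⟨v, hv, a, ha⟩ := Module.End.exists_common_eigenvector_of_odd_finrank _ rfl hB
    (fun i : σ => LinearMap.mulLeft ℝ (φ (X i)))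
    (fun i j => LinearMap.ext fun x => mul_left_comm _ _ _)
  have heval : ∀ p : MvPolynomial σ ℝ, φ p * v = eval a p • v := by
    intro p
    induction p using MvPolynomial.induction_on with
    | C r => rw [eval_C, Algebra.smul_def, ← algebraMap_eq, AlgHom.commutes]
    | add p q hp hq => rw [map_add, map_add, add_mul, hp, hq, add_smul]
    | mul_X p i hp =>
      have hi : φ (X i) * v = a i • v := ha i
      rw [map_mul, mul_assoc, hi, mul_smul_comm, hp, map_mul, eval_X, smul_smul, mul_comm]
  refine ⟨a, fun p hp => ?_⟩
  have := heval p
  rw [hp, zero_mul] at this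
  exact (smul_eq_zero.mp this.symm).resolve_right hv

theorem nonempty_quotient_span_equiv_of_bijective_adicMap {d : ℕ} (hd : 0 < d)
    {g : σ → MvPolynomial σ ℝ} (hg : Function.Bijective (adicMap d g)) :
    Nonempty ((MvPolynomial σ ℝ ⧸ Ideal.span (Set.range g)) ≃ₗ[ℝ] ((σ → Fin d) → ℝ)) := by
  let Ψ := LinearEquiv.ofBijective (adicMap d g) hg
  let Θ : MvPolynomial σ ℝ →ₗ[ℝ] ((σ → Fin d) → ℝ) := boxCoeff σ d ∘ₗ Ψ.symm.toLinearMap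
  have hΘ : Function.Surjective Θ := (boxCoeff_surjective d).comp Ψ.symm.surjective
  have hker : LinearMap.ker Θ = (Ideal.span (Set.range g)).restrictScalars ℝ := by
    ext p
    rw [LinearMap.mem_ker, Submodule.restrictScalars_mem]
    change boxCoeff σ d (Ψ.symm p) = 0 ↔ _
    rw [← adicMap_mem_span_iff hd hg]
    change Ψ (Ψ.symm p) ∈ _ ↔ _
    rw [LinearEquiv.apply_symm_apply]
  exact ⟨((Submodule.Quotient.restrictScalarsEquiv ℝ _).symm.trans
    (Submodule.quotEquivOfEq _ _ hker.symm)).trans (Θ.quotKerEquivOfSurjective hΘ)⟩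

theorem exists_eval_eq_zero_of_bijective_adicMap {d : ℕ} (hd : Odd d)
    {g : σ → MvPolynomial σ ℝ} (hg : Function.Bijective (adicMap d g)) :
    ∃ a : σ → ℝ, ∀ i, eval a (g i) = 0 := by
  classical
  obtain ⟨e⟩ := nonempty_quotient_span_equiv_of_bijective_adicMap hd.pos hg
  have hfin : FiniteDimensional ℝ (MvPolynomial σ ℝ ⧸ Ideal.span (Set.range g)) :=
    Module.Finite.equiv e.symm
  have hrank : Odd (Module.finrank ℝ (MvPolynomial σ ℝ ⧸ Ideal.span (Set.range g))) := by
    rw [e.finrank_eq, Module.finrank_fintype_fun_eq_card, Fintype.card_fun, Fintype.card_fin]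
    exact hd.pow
  obtain ⟨a, ha⟩ := exists_eval_eq_zero_of_odd_finrank hrank (Ideal.Quotient.mkₐ ℝ _)
  exact ⟨a, fun i => ha _ (Ideal.Quotient.eq_zero_iff_mem.mpr (Ideal.subset_span ⟨i, rfl⟩))⟩

theorem exists_le_eval_X_pow_add_eq_zero {d : ℕ} (hd : Odd d) (h : σ → MvPolynomial σ ℝ)
    (hh : ∀ i, (h i).totalDegree ≤ d) (B : ℝ) :
    ∃ s, B < s ∧ ∃ a : σ → ℝ, ∀ i, a i ^ d + s * eval a (h i) = 0 := by
  obtain ⟨s, hs, hB⟩ := ((countable_setOf_not_bijective_adicMap h hh).dense_compl ℝ).exists_gt B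
  simp only [Set.mem_compl_iff, Set.mem_ofPred_eq, not_not] at hs
  obtain ⟨a, ha⟩ := exists_eval_eq_zero_of_bijective_adicMap hd hs
  exact ⟨s, hB, a, fun i => by simpa using ha i⟩

end OddSystem

/-! ### Borsuk–Ulam by polynomial approximation. -/

open MvPolynomial

namespace BorsukUlamNLP

/-- The point `(x, 1)` of `ℝⁿ⁺¹`. -/
noncomputable def lift {n : ℕ} (x : Fin n → ℝ) : E (n + 1) :=
  WithLp.toLp 2 (Fin.snoc (α := fun _ => ℝ) x 1)

theorem lift_castSucc {n : ℕ} (x : Fin n → ℝ) (i : Fin n) : lift x i.castSucc = x i := by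
  simp [lift]

theorem lift_last {n : ℕ} (x : Fin n → ℝ) : lift x (Fin.last n) = 1 := by
  simp [lift]

theorem norm_lift_sq {n : ℕ} (x : Fin n → ℝ) : ‖lift x‖ ^ 2 = ∑ i, x i ^ 2 + 1 := by
  rw [EuclideanSpace.real_norm_sq_eq, Fin.sum_univ_castSucc, lift_last, one_pow]
  simp only [lift_castSucc]

theorem norm_lift_pos {n : ℕ} (x : Fin n → ℝ) : 0 < ‖lift x‖ := by
  refine (sq_pos_iff.mp ?_).lt_of_le' (norm_nonneg _)
  rw [norm_lift_sq]
  positivity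

/-- The point of the upper hemisphere on the ray through `(x, 1)`. -/
noncomputable def chart {n : ℕ} (x : Fin n → ℝ) : S n :=
  ⟨‖lift x‖⁻¹ • lift x, by
    rw [mem_sphere_zero_iff_norm, norm_smul, norm_inv, norm_norm,
      inv_mul_cancel₀ (norm_lift_pos x).ne']⟩

theorem norm_lift_mul_chart {n : ℕ} (x : Fin n → ℝ) (j : Fin (n + 1)) :
    ‖lift x‖ * (chart x : E (n + 1)) j = lift x j := by
  change ‖lift x‖ * (‖lift x‖⁻¹ * lift x j) = _
  rw [mul_inv_cancel_left₀ (norm_lift_pos x).ne']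

/-- `G`, extended to the upper half-space with homogeneity degree `d`, is in the chart `(x, 1)` a
polynomial of degree at most `d`. -/
def IsChartPolynomial {n : ℕ} (d : ℕ) (G : S n → ℝ) : Prop :=
  ∃ h : MvPolynomial (Fin n) ℝ, h.totalDegree ≤ d ∧ ∀ x, eval x h = ‖lift x‖ ^ d * G (chart x)

namespace IsChartPolynomial

variable {n d e : ℕ} {G K : S n → ℝ}

theorem add (hG : IsChartPolynomial d G) (hK : IsChartPolynomial d K) :
    IsChartPolynomial d (G + K) := by
  obtain ⟨g, hg, hg'⟩ := hG
  obtain ⟨k, hk, hk'⟩ := hK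
  refine ⟨g + k, (totalDegree_add _ _).trans (max_le hg hk), fun x => ?_⟩
  rw [map_add, hg', hk', Pi.add_apply, mul_add]

theorem mul (hG : IsChartPolynomial d G) (hK : IsChartPolynomial e K) :
    IsChartPolynomial (d + e) (G * K) := by
  obtain ⟨g, hg, hg'⟩ := hG
  obtain ⟨k, hk, hk'⟩ := hK
  refine ⟨g * k, (totalDegree_mul _ _).trans (add_le_add hg hk), fun x => ?_⟩
  rw [map_mul, hg', hk', Pi.mul_apply, pow_add]
  ring

theorem zero : IsChartPolynomial d (0 : S n → ℝ) :=
  ⟨0, by simp, by simp⟩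

theorem const (c : ℝ) : IsChartPolynomial 0 (fun _ : S n => c) :=
  ⟨C c, by simp, by simp⟩

theorem coord (j : Fin (n + 1)) : IsChartPolynomial 1 (fun u : S n => (u : E (n + 1)) j) := by
  simp only [IsChartPolynomial, pow_one, norm_lift_mul_chart]
  refine Fin.lastCases ⟨1, by simp, fun x => ?_⟩ (fun i => ⟨X i, by simp, fun x => ?_⟩) j
  · rw [map_one, lift_last]
  · rw [eval_X, lift_castSucc]

/-- Multiplying by `‖lift x‖ ^ 2`, itself a polynomial of degree at most 2, leaves `G` unchanged.
Degrees of equal parity can thus be equalised. -/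
theorem add_two_mul (hG : IsChartPolynomial d G) (k : ℕ) : IsChartPolynomial (d + 2 * k) G := by
  induction k with
  | zero => exact hG
  | succ k ih =>
    obtain ⟨g, hg, hg'⟩ := ih
    refine ⟨g * (∑ i, X i ^ 2 + 1), ?_, fun x => ?_⟩
    · rw [mul_add_one 2 k, ← add_assoc]
      refine (totalDegree_mul _ _).trans (add_le_add hg ?_)
      refine (totalDegree_add _ _).trans (max_le (totalDegree_finsetSum_le fun i _ => ?_) (by simp))
      rw [totalDegree_X_pow]
    · simp only [map_mul, hg', map_add, map_sum, map_pow, eval_X, map_one, ← norm_lift_sq]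
      rw [mul_add 2 k 1, ← add_assoc, pow_add]
      ring

end IsChartPolynomial

theorem exists_even_odd_isChartPolynomial {n : ℕ} {G : C(S n, ℝ)}
    (hG : G ∈ Algebra.adjoin ℝ (Set.range fun j : Fin (n + 1) =>
      (⟨fun u => (u : E (n + 1)) j, by fun_prop⟩ : C(S n, ℝ)))) :
    ∃ (k : ℕ) (G₀ G₁ : S n → ℝ), (⇑G = G₀ + G₁) ∧ (∀ u, G₀ (-u) = G₀ u) ∧
      (∀ u, G₁ (-u) = -G₁ u) ∧ IsChartPolynomial (2 * k) G₀ ∧ IsChartPolynomial (2 * k + 1) G₁ := by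
  induction hG using Algebra.adjoin_induction with
  | mem G hG =>
    obtain ⟨j, rfl⟩ := hG
    exact ⟨0, 0, fun u => (u : E (n + 1)) j, by ext; simp, by simp, fun u => rfl,
      .zero, .coord j⟩
  | algebraMap c =>
    exact ⟨0, fun _ => c, 0, by ext; simp, by simp, by simp, .const c, .zero⟩
  | add G K _ _ hG hK =>
    obtain ⟨k, G₀, G₁, hG, h0, h1, hp0, hp1⟩ := hG
    obtain ⟨l, K₀, K₁, hK, h0', h1', hp0', hp1'⟩ := hK
    refine ⟨k + l, G₀ + K₀, G₁ + K₁, ?_, fun u => ?_, fun u => ?_, ?_, ?_⟩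
    · rw [ContinuousMap.coe_add, hG, hK]; abel
    · simp [h0, h0']
    · simp [h1, h1']; ring
    · have := (hp0.add_two_mul l).add (K := K₀)
        (by have := hp0'.add_two_mul k; rwa [add_comm] at this)
      rwa [← mul_add] at this
    · have h2 : 2 * k + 1 + 2 * l = 2 * (k + l) + 1 := by ring
      have h3 : 2 * l + 1 + 2 * k = 2 * (k + l) + 1 := by ring
      exact (h2 ▸ hp1.add_two_mul l).add (h3 ▸ hp1'.add_two_mul k)
  | mul G K _ _ hG hK =>
    obtain ⟨k, G₀, G₁, hG, h0, h1, hp0, hp1⟩ := hG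
    obtain ⟨l, K₀, K₁, hK, h0', h1', hp0', hp1'⟩ := hK
    refine ⟨k + l + 1, G₀ * K₀ + G₁ * K₁, G₀ * K₁ + G₁ * K₀, ?_, fun u => ?_, fun u => ?_, ?_, ?_⟩
    · rw [ContinuousMap.coe_mul, hG, hK]; ring
    · simp [h0, h0', h1, h1']
    · simp [h0, h0', h1, h1']; ring
    · have h2 : 2 * k + 2 * l + 2 * 1 = 2 * (k + l + 1) := by ring
      have h3 : 2 * k + 1 + (2 * l + 1) = 2 * (k + l + 1) := by ring
      exact (h2 ▸ (hp0.mul hp0').add_two_mul 1).add (h3 ▸ hp1.mul hp1')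
    · have h2 : 2 * k + (2 * l + 1) + 2 * 1 = 2 * (k + l + 1) + 1 := by ring
      have h3 : 2 * k + 1 + 2 * l + 2 * 1 = 2 * (k + l + 1) + 1 := by ring
      exact (h2 ▸ (hp0.mul hp1').add_two_mul 1).add (h3 ▸ (hp1.mul hp0').add_two_mul 1)

theorem exists_isChartPolynomial_near {n : ℕ} {F : S n → ℝ} (hF : Continuous F)
    (hodd : ∀ u, F (-u) = -F u) {ε : ℝ} (hε : 0 < ε) :
    ∃ (k : ℕ) (G : S n → ℝ), IsChartPolynomial (2 * k + 1) G ∧ ∀ u, |G u - F u| < ε := by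
  set A := Algebra.adjoin ℝ (Set.range fun j : Fin (n + 1) =>
    (⟨fun u => (u : E (n + 1)) j, by fun_prop⟩ : C(S n, ℝ)))
  have hsep : A.SeparatesPoints := by
    intro u v huv
    have : ∃ j, (u : E (n + 1)) j ≠ (v : E (n + 1)) j := by
      by_contra! h
      exact huv (Subtype.ext (PiLp.ext h))
    obtain ⟨j, hj⟩ := this
    exact ⟨_, ⟨_, Algebra.subset_adjoin ⟨j, rfl⟩, rfl⟩, hj⟩
  obtain ⟨⟨G, hGA⟩, hG⟩ :=
    ContinuousMap.exists_mem_subalgebra_near_continuous_of_separatesPoints A hsep F hF ε hε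
  obtain ⟨k, G₀, G₁, hsum, h0, h1, -, hp⟩ := exists_even_odd_isChartPolynomial hGA
  -- The error of the odd part is half the difference of the errors of `G` at `u` and `-u`.
  refine ⟨k, G₁, hp, fun u => ?_⟩
  have e1 := hG u
  have e2 := hG (-u)
  simp only [hsum, Pi.add_apply, h0, h1, hodd, Real.norm_eq_abs, abs_lt] at e1 e2
  rw [abs_lt]
  constructor <;> linarith

theorem exists_forall_abs_lt {n : ℕ} {F : Fin n → S n → ℝ} (hF : ∀ i, Continuous (F i))
    (hodd : ∀ i u, F i (-u) = -F i u) {ε : ℝ} (hε : 0 < ε) : ∃ u, ∀ i, |F i u| < 2 * ε := by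
  choose k G hG hGF using fun i => exists_isChartPolynomial_near (hF i) (hodd i) hε
  set N := ∑ i, k i
  have hG' : ∀ i, IsChartPolynomial (2 * N + 1) (G i) := by
    intro i
    have hle : k i ≤ N := Finset.single_le_sum (fun _ _ => Nat.zero_le _) (Finset.mem_univ i)
    have := (hG i).add_two_mul (N - k i)
    rwa [show 2 * k i + 1 + 2 * (N - k i) = 2 * N + 1 by omega] at this
  choose h hdeg hh using hG'
  obtain ⟨s, hs, a, ha⟩ := exists_le_eval_X_pow_add_eq_zero ⟨N, rfl⟩ h hdeg ε⁻¹
  have hs0 : 0 < s := (inv_pos.mpr hε).trans hs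
  refine ⟨chart a, fun i => ?_⟩
  set u := chart a with hu
  have hr := pow_pos (norm_lift_pos a) (2 * N + 1)
  -- The polynomial equation at `a` is `‖lift a‖ ^ (2 * N + 1)` times this one.
  have h1 : (u : E (n + 1)) i.castSucc ^ (2 * N + 1) + s * G i u = 0 := by
    have := ha i
    rw [hh, ← lift_castSucc a i, ← norm_lift_mul_chart, mul_pow, ← hu] at this
    refine (mul_eq_zero.mp ?_).resolve_left hr.ne'
    linear_combination this
  have h2 : |(u : E (n + 1)) i.castSucc| ≤ 1 := by
    have := PiLp.norm_apply_le (u : E (n + 1)) i.castSucc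
    rwa [mem_sphere_zero_iff_norm.mp u.2, Real.norm_eq_abs] at this
  have h3 : s * |G i u| ≤ 1 := by
    rw [← abs_of_pos hs0, ← abs_mul, ← neg_eq_of_add_eq_zero_right h1, abs_neg, abs_pow]
    exact pow_le_one₀ (abs_nonneg _) h2
  have h4 : |G i u| < ε := by
    by_contra! hc
    have : 1 < s * ε := by rwa [inv_lt_iff_one_lt_mul₀ hε] at hs
    nlinarith
  have h5 := hGF i u
  rw [abs_lt] at h4 h5 ⊢
  constructor <;> linarith

/-- The **Borsuk–Ulam theorem**. -/
theorem borsuk_ulam {n : ℕ} {F : Fin n → S n → ℝ} (hF : ∀ i, Continuous (F i))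
    (hodd : ∀ i u, F i (-u) = -F i u) : ∃ u, ∀ i, F i u = 0 := by
  have : Nonempty (S n) := ⟨chart 0⟩
  obtain ⟨u, -, hu⟩ := isCompact_univ.exists_isMinOn Set.univ_nonempty
    (f := fun u => ‖fun i => F i u‖) (continuous_norm.comp (continuous_pi hF)).continuousOn
  refine ⟨u, congrFun (f := fun i => F i u) (norm_le_zero_iff.mp
    (le_of_forall_pos_le_add fun ε hε => ?_))⟩
  obtain ⟨v, hv⟩ := exists_forall_abs_lt hF hodd (half_pos hε)
  rw [zero_add]
  refine (hu (Set.mem_univ v)).trans ?_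
  refine (pi_norm_le_iff_of_nonneg hε.le).mpr fun j => ?_
  have := (hv j).le
  rwa [mul_div_cancel₀ _ two_ne_zero] at this

end BorsukUlamNLP

/-! ### Continuity of the oscillation on a half-space section. -/

open Filter Topology

namespace BorsukUlamNLP

variable {n : ℕ}

theorem head_neg (u : S n) : head (-u) = -head u := rfl

theorem last_neg (u : S n) : last (-u) = -last u := rfl

theorem halfPos_neg (u : S n) : halfPos (-u) = halfNeg u := by
  ext x
  simp [halfPos, halfNeg, head_neg, last_neg, inner_neg_left]

theorem continuous_head : Continuous (head : S n → E n) := by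
  unfold head
  fun_prop

theorem continuous_last : Continuous (last : S n → ℝ) := by
  unfold last
  fun_prop

theorem not_head_eq_zero_and_last_eq_zero (u : S n) : ¬ (head u = 0 ∧ last u = 0) := by
  rintro ⟨h1, h2⟩
  have : (u : E (n + 1)) = 0 := by
    refine PiLp.ext fun j => Fin.lastCases h2 (fun i => ?_) j
    exact congrArg (fun v : E n => v i) h1
  have h3 := mem_sphere_zero_iff_norm.mp u.2
  rw [this, norm_zero] at h3
  exact zero_ne_one h3

/-- The oscillation of `g (·, u)` on `A ∩ H⁺`, which is `0` if that set is empty. -/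
noncomputable def osc (A : Set (E n)) (g : E n × S n → ℝ) (u : S n) : ℝ :=
  sSup (insert 0 ((fun p : E n × E n => g (p.1, u) - g (p.2, u)) ''
    ((A ∩ halfPos u) ×ˢ (A ∩ halfPos u))))

variable {A : Set (E n)} {g : E n × S n → ℝ}

theorem isClosed_halfPos (u : S n) : IsClosed (halfPos u) :=
  isClosed_le continuous_const (by fun_prop)

theorem isGreatest_osc (hA : IsCompact A) (hg : Continuous g) (u : S n) :
    IsGreatest (insert 0 ((fun p : E n × E n => g (p.1, u) - g (p.2, u)) ''
      ((A ∩ halfPos u) ×ˢ (A ∩ halfPos u)))) (osc A g u) := by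
  have hc := hA.inter_right (isClosed_halfPos u)
  exact (((hc.prod hc).image (by fun_prop)).insert 0).isGreatest_sSup (Set.insert_nonempty _ _)

theorem osc_nonneg (hA : IsCompact A) (hg : Continuous g) (u : S n) : 0 ≤ osc A g u :=
  (isGreatest_osc hA hg u).2 (Set.mem_insert _ _)

theorem sub_le_osc (hA : IsCompact A) (hg : Continuous g) {u : S n} {x y : E n}
    (hx : x ∈ A ∩ halfPos u) (hy : y ∈ A ∩ halfPos u) : g (x, u) - g (y, u) ≤ osc A g u :=
  (isGreatest_osc hA hg u).2 (Set.mem_insert_of_mem _ ⟨(x, y), ⟨hx, hy⟩, rfl⟩)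

theorem osc_eq_zero_or_exists (hA : IsCompact A) (hg : Continuous g) (u : S n) :
    osc A g u = 0 ∨
      ∃ x ∈ A ∩ halfPos u, ∃ y ∈ A ∩ halfPos u, g (x, u) - g (y, u) = osc A g u := by
  rcases (isGreatest_osc hA hg u).1 with h | ⟨⟨x, y⟩, ⟨hx, hy⟩, h⟩
  · exact Or.inl h
  · exact Or.inr ⟨x, hx, y, hy, h⟩

theorem osc_eq_sub (hA : IsCompact A) (hg : Continuous g) {u : S n} {M m : ℝ}
    (hM : IsGreatest ((fun x => g (x, u)) '' (A ∩ halfPos u)) M)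
    (hm : IsLeast ((fun x => g (x, u)) '' (A ∩ halfPos u)) m) : osc A g u = M - m := by
  obtain ⟨x, hx, rfl⟩ := hM.1
  obtain ⟨y, hy, rfl⟩ := hm.1
  refine le_antisymm ?_ (sub_le_osc hA hg hx hy)
  rcases osc_eq_zero_or_exists hA hg u with h | ⟨x', hx', y', hy', h⟩
  · rw [h]
    exact sub_nonneg.mpr (hM.2 ⟨y, hy, rfl⟩)
  · rw [← h]
    exact sub_le_sub (hM.2 ⟨x', hx', rfl⟩) (hm.2 ⟨y', hy', rfl⟩)

theorem osc_of_eq_empty {u : S n} (h : A ∩ halfPos u = ∅) : osc A g u = 0 := by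
  simp [osc, h]

theorem isClosed_setOf_le_osc (hA : IsCompact A) (hg : Continuous g) (c : ℝ) :
    IsClosed {u | c ≤ osc A g u} := by
  rcases le_or_gt c 0 with hc | hc
  · convert isClosed_univ
    exact Set.eq_univ_of_forall fun u => hc.trans (osc_nonneg hA hg u)
  -- For `c > 0` the default value `0` plays no role, and the set is the projection of a compact set
  -- of triples `(u, x, y)`.
  let K : Set (S n × E n × E n) := {q | last q.1 ≤ inner ℝ (head q.1) q.2.1} ∩
    {q | last q.1 ≤ inner ℝ (head q.1) q.2.2} ∩ {q | c ≤ g (q.2.1, q.1) - g (q.2.2, q.1)}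
  have hK : IsClosed K := by
    have h1 := continuous_head (n := n)
    have h2 := continuous_last (n := n)
    exact ((isClosed_le (by fun_prop) (by fun_prop)).inter
      (isClosed_le (by fun_prop) (by fun_prop))).inter (isClosed_le (by fun_prop) (by fun_prop))
  have hcomp : IsCompact ((Set.univ ×ˢ A ×ˢ A) ∩ K) :=
    (isCompact_univ.prod (hA.prod hA)).inter_right hK
  convert (hcomp.image continuous_fst).isClosed
  ext u
  constructor
  · intro hu
    change c ≤ osc A g u at hu
    rcases osc_eq_zero_or_exists hA hg u with h | ⟨x, hx, y, hy, h⟩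
    · exact absurd hu (by rw [h]; exact not_le.mpr hc)
    · exact ⟨(u, x, y), ⟨⟨trivial, hx.1, hy.1⟩, ⟨hx.2, hy.2⟩, hu.trans_eq h.symm⟩, rfl⟩
  · rintro ⟨⟨u, x, y⟩, ⟨⟨-, hx, hy⟩, ⟨hx', hy'⟩, h⟩, rfl⟩
    exact le_trans h (sub_le_osc hA hg ⟨hx, hx'⟩ ⟨hy, hy'⟩)

theorem mem_frontier_of_forall_inner_le {v x : E n} (hv : v ≠ 0) (hx : x ∈ A)
    (h : ∀ z ∈ A, inner ℝ v z ≤ inner ℝ v x) : x ∈ frontier A := by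
  refine ⟨subset_closure hx, fun hi => ?_⟩
  have hc : Tendsto (fun t : ℝ => x + t • v) (𝓝[>] 0) (𝓝 x) := by
    have : Continuous fun t : ℝ => x + t • v := by fun_prop
    simpa using (this.tendsto 0).mono_left nhdsWithin_le_nhds
  obtain ⟨t, ht, ht0⟩ :=
    ((hc.eventually (mem_interior_iff_mem_nhds.mp hi)).and self_mem_nhdsWithin).exists
  have h1 := h _ ht
  rw [inner_add_right, inner_smul_right] at h1
  have h2 := mul_pos (show (0 : ℝ) < t from ht0) (real_inner_self_pos.mpr hv)
  linarith

/-- Otherwise the boundary of `H⁺` would be a supporting hyperplane meeting `A` in two points. The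
case `head u = 0` is excluded because `last u` would vanish too. -/
theorem exists_last_lt_inner
    (hA : ∀ x ∈ frontier A, ∀ H, IsSupportingHyperplaneAt A H x → ∃ p, A ∩ H = {p})
    {u : S n} {x y : E n} (hx : x ∈ A ∩ halfPos u) (hy : y ∈ A ∩ halfPos u) (hxy : x ≠ y) :
    ∃ z ∈ A, last u < inner ℝ (head u) z := by
  by_contra! hc
  have heq : ∀ z ∈ A ∩ halfPos u, inner ℝ (head u) z = last u := fun z hz =>
    le_antisymm (hc z hz.1) hz.2
  have hhead : head u ≠ 0 := by
    intro h0
    have := heq x hx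
    rw [h0, inner_zero_left] at this
    exact not_head_eq_zero_and_last_eq_zero u ⟨h0, this.symm⟩
  have hfr : x ∈ frontier A :=
    mem_frontier_of_forall_inner_le hhead hx.1 fun z hz => (hc z hz).trans (heq x hx).ge
  obtain ⟨p, hp⟩ := hA x hfr {z | inner ℝ (head u) z = last u}
    ⟨head u, last u, hhead, rfl, heq x hx, hc⟩
  have h1 : x ∈ ({p} : Set (E n)) := hp ▸ ⟨hx.1, heq x hx⟩
  have h2 : y ∈ ({p} : Set (E n)) := hp ▸ ⟨hy.1, heq y hy⟩
  exact hxy (h1.trans h2.symm)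

/-- This is where strict convexity enters. Two points realising a positive oscillation are moved
slightly towards a point of `A` strictly inside `H⁺`; they become strictly inside themselves, hence
stay in `halfPos v` for `v` near `u`. -/
theorem isOpen_setOf_lt_osc (hA : IsCompact A) (hconv : Convex ℝ A)
    (hsupp : ∀ x ∈ frontier A, ∀ H, IsSupportingHyperplaneAt A H x → ∃ p, A ∩ H = {p})
    (hg : Continuous g) (c : ℝ) : IsOpen {u | c < osc A g u} := by
  rcases lt_or_ge c 0 with hc | hc
  · convert isOpen_univ
    exact Set.eq_univ_of_forall fun u => hc.trans_le (osc_nonneg hA hg u)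
  rw [isOpen_iff_mem_nhds]
  intro u hu
  change c < osc A g u at hu
  rcases osc_eq_zero_or_exists hA hg u with h | ⟨x, hx, y, hy, h⟩
  · exact absurd hu (by rw [h]; exact not_lt.mpr hc)
  rw [← h] at hu
  have hxy : x ≠ y := by
    rintro rfl
    rw [sub_self] at hu
    exact hc.not_gt hu
  obtain ⟨z, hz, hzu⟩ := exists_last_lt_inner hsupp hx hy hxy
  have hev : ∀ᶠ t : ℝ in 𝓝 0,
      c < g (AffineMap.lineMap x z t, u) - g (AffineMap.lineMap y z t, u) := by
    have hcont : Continuous fun t : ℝ =>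
        g (AffineMap.lineMap x z t, u) - g (AffineMap.lineMap y z t, u) := by
      have h1 : ∀ w : E n, Continuous fun t : ℝ => AffineMap.lineMap w z t := fun w =>
        AffineMap.lineMap_continuous
      have := h1 x
      have := h1 y
      fun_prop
    exact (hcont.tendsto 0).eventually (lt_mem_nhds (by simpa using hu))
  obtain ⟨t, ht, ht0, ht1⟩ := ((hev.filter_mono nhdsWithin_le_nhds).and
    (Ioo_mem_nhdsGT (zero_lt_one (α := ℝ)))).exists
  have hmem : ∀ w ∈ A, AffineMap.lineMap w z t ∈ A := fun w hw =>
    hconv.lineMap_mem hw hz ⟨ht0.le, ht1.le⟩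
  have hlt : ∀ w ∈ halfPos u, last u < inner ℝ (head u) (AffineMap.lineMap w z t) := by
    intro w hw
    change last u ≤ inner ℝ (head u) w at hw
    rw [AffineMap.lineMap_apply_module, inner_add_right, inner_smul_right, inner_smul_right]
    nlinarith
  have hnear : ∀ w ∈ halfPos u, ∀ᶠ v in 𝓝 u, AffineMap.lineMap w z t ∈ halfPos v := by
    intro w hw
    have h1 := continuous_head (n := n)
    have h2 := continuous_last (n := n)
    have h3 : IsOpen {v : S n | last v < inner ℝ (head v) (AffineMap.lineMap w z t)} :=
      isOpen_lt h2 (by fun_prop)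
    filter_upwards [h3.mem_nhds (hlt w hw)] with v hv using le_of_lt hv
  have hgv : ∀ᶠ v in 𝓝 u, c < g (AffineMap.lineMap x z t, v) - g (AffineMap.lineMap y z t, v) :=
    (isOpen_lt continuous_const (by fun_prop)).mem_nhds ht
  filter_upwards [hnear x hx.2, hnear y hy.2, hgv] with v hxv hyv hv
  exact hv.trans_le (sub_le_osc hA hg ⟨hmem x hx.1, hxv⟩ ⟨hmem y hy.1, hyv⟩)

theorem continuous_osc (hA : IsCompact A) (hconv : Convex ℝ A)
    (hsupp : ∀ x ∈ frontier A, ∀ H, IsSupportingHyperplaneAt A H x → ∃ p, A ∩ H = {p})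
    (hg : Continuous g) : Continuous (osc A g) := by
  rw [continuous_iff_lower_upperSemicontinuous, lowerSemicontinuous_iff_isOpen_preimage,
    upperSemicontinuous_iff_isOpen_preimage]
  refine ⟨isOpen_setOf_lt_osc hA hconv hsupp hg, fun c => ?_⟩
  convert (isClosed_setOf_le_osc hA hg c).isOpen_compl
  ext u
  simp

theorem eq_of_osc_eq_zero (hA : IsCompact A) (hg : Continuous g) {u : S n}
    (hu : A ∩ halfPos u = A) (h : osc A g u = 0) {x y : E n} (hx : x ∈ A) (hy : y ∈ A) :
    g (x, u) = g (y, u) := by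
  have h1 := sub_le_osc hA hg (u := u) (hu.symm ▸ hx) (hu.symm ▸ hy)
  have h2 := sub_le_osc hA hg (u := u) (hu.symm ▸ hy) (hu.symm ▸ hx)
  linarith

theorem inter_halfPos_eq_of_inter_halfNeg_eq_empty {u : S n} (h : A ∩ halfNeg u = ∅) :
    A ∩ halfPos u = A := by
  refine Set.inter_eq_left.mpr fun x hx => ?_
  refine (le_total (last u) (inner ℝ (head u) x)).resolve_right fun hle => ?_
  exact Set.eq_empty_iff_forall_notMem.mp h x ⟨hx, hle⟩

end BorsukUlamNLP

/-! ### The theorem, from Borsuk–Ulam applied to oscillations. -/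

theorem mainTheorem2 (n : ℕ)
    (A : Fin n → Set (BorsukUlamNLP.E n))
    (f : Fin n → BorsukUlamNLP.E n × BorsukUlamNLP.S n → ℝ)
    (hA_compact : ∀ i, IsCompact (A i))
    (hA_convex : ∀ i, Convex ℝ (A i))
    (hA_interior : ∀ i, (interior (A i)).Nonempty)
    (hA_support : ∀ i, ∀ x ∈ frontier (A i), ∀ H : Set (BorsukUlamNLP.E n),
      BorsukUlamNLP.IsSupportingHyperplaneAt (A i) H x → ∃ p, A i ∩ H = {p})
    (hf_cont : ∀ i, Continuous (f i))
    (hf_odd : ∀ i x u, f i (x, -u) = -f i (x, u)) :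
    ∃ u : BorsukUlamNLP.S n, ∀ i,
      ((A i ∩ BorsukUlamNLP.halfPos u).Nonempty ∧ (A i ∩ BorsukUlamNLP.halfNeg u).Nonempty ∧
        ∃ M₁ m₁ M₂ m₂ : ℝ,
          IsGreatest ((fun x => f i (x, u)) '' (A i ∩ BorsukUlamNLP.halfPos u)) M₁ ∧
          IsLeast ((fun x => f i (x, u)) '' (A i ∩ BorsukUlamNLP.halfPos u)) m₁ ∧
          IsGreatest ((fun x => f i (x, u)) '' (A i ∩ BorsukUlamNLP.halfNeg u)) M₂ ∧
          IsLeast ((fun x => f i (x, u)) '' (A i ∩ BorsukUlamNLP.halfNeg u)) m₂ ∧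
          M₁ - m₁ = M₂ - m₂) ∨
      (((A i ∩ BorsukUlamNLP.halfPos u = ∅ ∧ A i ∩ BorsukUlamNLP.halfNeg u = A i) ∨
          (A i ∩ BorsukUlamNLP.halfNeg u = ∅ ∧ A i ∩ BorsukUlamNLP.halfPos u = A i)) ∧
        ∃ c : ℝ, ∀ x ∈ A i, f i (x, u) = c) := by
  have hc := fun i => BorsukUlamNLP.continuous_osc (hA_compact i) (hA_convex i) (hA_support i)
    (hf_cont i)
  obtain ⟨u, hu⟩ := BorsukUlamNLP.borsuk_ulam
    (F := fun i u => BorsukUlamNLP.osc (A i) (f i) u - BorsukUlamNLP.osc (A i) (f i) (-u))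
    (fun i => (hc i).sub ((hc i).comp continuous_neg)) (fun i u => by simp)
  refine ⟨u, fun i => ?_⟩
  have hosc : BorsukUlamNLP.osc (A i) (f i) u = BorsukUlamNLP.osc (A i) (f i) (-u) :=
    sub_eq_zero.mp (hu i)
  have hfu : Continuous fun x => f i (x, u) := by
    have := hf_cont i
    fun_prop
  obtain ⟨x₀, hx₀⟩ := (hA_interior i).mono interior_subset
  rcases (A i ∩ BorsukUlamNLP.halfPos u).eq_empty_or_nonempty with hP | hP
  · have hN : A i ∩ BorsukUlamNLP.halfPos (-u) = A i := by
      apply BorsukUlamNLP.inter_halfPos_eq_of_inter_halfNeg_eq_empty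
      rwa [← BorsukUlamNLP.halfPos_neg, neg_neg]
    refine Or.inr ⟨Or.inl ⟨hP, by rwa [← BorsukUlamNLP.halfPos_neg]⟩, f i (x₀, u), fun x hx => ?_⟩
    have h0 : BorsukUlamNLP.osc (A i) (f i) (-u) = 0 := by
      rw [← hosc, BorsukUlamNLP.osc_of_eq_empty hP]
    have := BorsukUlamNLP.eq_of_osc_eq_zero (hA_compact i) (hf_cont i) hN h0 hx hx₀
    rwa [hf_odd, hf_odd, neg_inj] at this
  rcases (A i ∩ BorsukUlamNLP.halfNeg u).eq_empty_or_nonempty with hN | hN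
  · have hP' := BorsukUlamNLP.inter_halfPos_eq_of_inter_halfNeg_eq_empty hN
    refine Or.inr ⟨Or.inr ⟨hN, hP'⟩, f i (x₀, u), fun x hx => ?_⟩
    have h0 : BorsukUlamNLP.osc (A i) (f i) u = 0 := by
      rw [hosc, BorsukUlamNLP.osc_of_eq_empty (by rwa [BorsukUlamNLP.halfPos_neg])]
    exact BorsukUlamNLP.eq_of_osc_eq_zero (hA_compact i) (hf_cont i) hP' h0 hx hx₀
  have hcP := ((hA_compact i).inter_right (BorsukUlamNLP.isClosed_halfPos u)).image hfu
  have hcN := ((hA_compact i).inter_right (BorsukUlamNLP.isClosed_halfPos (-u))).image hfu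
  rw [BorsukUlamNLP.halfPos_neg] at hcN
  have hM₁ := hcP.isGreatest_sSup (hP.image _)
  have hm₁ := hcP.isLeast_sInf (hP.image _)
  have hM₂ := hcN.isGreatest_sSup (hN.image _)
  have hm₂ := hcN.isLeast_sInf (hN.image _)
  refine Or.inl ⟨hP, hN, _, _, _, _, hM₁, hm₁, hM₂, hm₂, ?_⟩
  rw [← BorsukUlamNLP.osc_eq_sub (hA_compact i) (hf_cont i) hM₁ hm₁, hosc]
  -- Passing to `-u` negates the values, so maximum and minimum swap roles and their difference is
  -- unchanged.
  have himage : (fun x => f i (x, -u)) '' (A i ∩ BorsukUlamNLP.halfPos (-u)) =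
      (fun r => -r) '' ((fun x => f i (x, u)) '' (A i ∩ BorsukUlamNLP.halfNeg u)) := by
    rw [BorsukUlamNLP.halfPos_neg, Set.image_image]
    simp only [hf_odd]
  have hanti : Antitone fun r : ℝ => -r := fun _ _ => neg_le_neg
  have hM := hanti.map_isLeast hm₂
  have hm := hanti.map_isGreatest hM₂
  rw [← himage] at hM hm
  rw [BorsukUlamNLP.osc_eq_sub (hA_compact i) (hf_cont i) hM hm, neg_sub_neg]
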